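/- For $1\le\alpha\le 2$ and $k\in\mathbb Z$ let $$g_k^{(\alpha)}=\frac{(-1)^k\,\Gamma(\alpha+1)}{\Gamma\left(\frac{\alpha}{2}-k+1\right)\Gamma\left(\frac{\alpha}{2}+k+1\right)}$$ be the fractional centred difference coefficients (with $1/\Gamma=0$ at the poles of $\Gamma$). For $1<\alpha<2$ put $$S(\alpha)=-\frac{\Gamma(\alpha+1)}{\Gamma\left(\frac{\alpha}{2}-1\right)\Gamma\left(\frac{\alpha}{2}+3\right)}.$$ If $1<\alpha<2$, then: (i) for every integer $k\ge 3$, $$S(\alpha)\left(\frac{\alpha+4}{\alpha+2k}\right)^{2(\alpha+1)}<\left|g_k^{(\alpha)}\right|<S(\alpha)\left(\frac{\alpha+6}{\alpha+2(k+1)}\right)^{\alpha+1};$$ (ii) for all integers $m\ge n\ge 3$, $$P_1(m,n,\alpha)\frac{(\alpha+4)^{2(\alpha+1)}}{2(2\alpha+1)}<\sum_{k=n}^{m}\left|g_k^{(\alpha)}\right|<P_2(m,n,\alpha)\frac{(\alpha+6)^{\alpha+1}}{2\alpha},$$ where $P_1(m,n,\alpha)=S(\alpha)\left[(\alpha+2n)^{-(2\alpha+1)}-(\alpha+2m+2)^{-(2\alpha+1)}\right]$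 and $P_2(m,n,\alpha)=S(\alpha)\left[(\alpha+2n)^{-\alpha}-(\alpha+2m+2)^{-\alpha}\right]$; (iii) for every integer $n\ge 3$ the series $\sum_{k\ge n}|g_k^{(\alpha)}|$ converges and $$Q_1(n,\alpha)\frac{(\alpha+4)^{2(\alpha+1)}}{2(2\alpha+1)}<\sum_{k=n}^{\infty}\left|g_k^{(\alpha)}\right|<Q_2(n,\alpha)\frac{(\alpha+6)^{\alpha+1}}{2\alpha},$$ where $Q_1(n,\alpha)=\dfrac{S(\alpha)}{(\alpha+2n)^{2\alpha+1}}$ and $Q_2(n,\alpha)=\dfrac{S(\alpha)}{(\alpha+2n)^{\alpha}}$; (iv) the series $\sum_{k\in\mathbb Z,\,k\ne0}|g_k^{(\alpha)}|$ converges and $$\frac{2^{1+\alpha}}{(1+\alpha)\pi}\le\sum_{k=-\infty,\,k\neq0}^{\infty}\left|g_k^{(\alpha)}\right|\le\frac{2^{1+\alpha}}{\pi}.$$ Moreover: (v) if $1\le\alpha_1<\alpha_2\le2$, then $g_k^{(\alpha_1)}<g_k^{(\alpha_2)}$ for every integer $k$ with $|k|\neq1$, and $g_k^{(\alpha_1)}>g_k^{(\alpha_2)}$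 for $k=\pm1$. -/

import Mathlib

noncomputable section

namespace FracCentred

/-- The fractional centred difference coefficient
`g_k^{(α)} = (-1)^k Γ(α+1) / (Γ(α/2 - k + 1) Γ(α/2 + k + 1))`, for every integer `k`.
At the poles of `Γ` the real Gamma function of Mathlib takes the value `0`, and division by `0`
gives `0`, which agrees with the usual convention that `1/Γ` vanishes there. -/
def g (α : ℝ) (k : ℤ) : ℝ :=
  (-1 : ℝ) ^ k * Real.Gamma (α + 1) /
    (Real.Gamma (α / 2 - k + 1) * Real.Gamma (α / 2 + k + 1))

/-- `S(α) = -Γ(α+1) / (Γ(α/2 - 1) Γ(α/2 + 3))`; it is positive for `1 < α < 2`. -/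
def S (α : ℝ) : ℝ :=
  -(Real.Gamma (α + 1) / (Real.Gamma (α / 2 - 1) * Real.Gamma (α / 2 + 3)))

/-- The factor in the lower bound of the finite sums. -/
def P₁ (m n : ℕ) (α : ℝ) : ℝ :=
  S α * ((α + 2 * n) ^ (-(2 * α + 1)) - (α + 2 * m + 2) ^ (-(2 * α + 1)))

/-- The factor in the upper bound of the finite sums. -/
def P₂ (m n : ℕ) (α : ℝ) : ℝ :=
  S α * ((α + 2 * n) ^ (-α) - (α + 2 * m + 2) ^ (-α))

/-- The factor in the lower bound of the infinite sums. -/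
def Q₁ (n : ℕ) (α : ℝ) : ℝ := S α / (α + 2 * n) ^ (2 * α + 1)

/-- The factor in the upper bound of the infinite sums. -/
def Q₂ (n : ℕ) (α : ℝ) : ℝ := S α / (α + 2 * n) ^ α

end FracCentred

end

namespace FracCentred

open Filter Topology

/-! The functional equation of `Γ` gives `g_{k+1} = (k - α/2)/(k + 1 + α/2) · g_k`. For `0 < α < 2`
this makes `g_k` negative for `k ≥ 1`, with `|g_{k+1}| = (1 - 2p/y)|g_k|`, where `p = α + 1` and `y
= α + 2(k+1)`. Since `|g_2| = S`, induction yields (i) once `1 - 2p/y` lies strictly between `(1 -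
2/y)^(2p)` and `(y/(y+2))^p`. Bernoulli's inequality bounds the resulting powers by telescoping
differences, whence (ii) and (iii). The recurrence also makes `|g_k|` itself a telescoping
difference, so the sum over `k ≠ 0` equals `g_0`. Legendre duplication writes `g_0²` as an
elementary factor times `V((α+1)/2)`; `V` is decreasing, and its values at `1` and `3/2` give (iv).
For (v), `g_0` increases by log-convexity of `Γ`, `|g_2|` decreases by the formula for `g_0²`, and
the contraction factor decreases in `α`, which carries this to all `k ≥ 2`. -/

/-! ### Recurrence and signs -/

theorem g_neg (α : ℝ) (k : ℤ) : g α (-k) = g α k := by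
  unfold g
  rw [zpow_neg, ← inv_zpow]
  push_cast
  rw [mul_comm (Real.Gamma (α / 2 - -(k : ℝ) + 1)), sub_neg_eq_add, ← sub_eq_add_neg]
  norm_num

theorem g_succ {α : ℝ} (hα : 0 < α) (k : ℕ) (hk : α / 2 - k ≠ 0) :
    g α ((k + 1 : ℕ) : ℤ) = (k - α / 2) / (k + 1 + α / 2) * g α (k : ℤ) := by
  unfold g
  have hp : 0 < α / 2 + k + 1 := by positivity
  have e1 : Real.Gamma (α / 2 - ((k : ℤ) : ℝ) + 1) = (α / 2 - k) * Real.Gamma (α / 2 - k) := by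
    push_cast
    exact Real.Gamma_add_one hk
  have e2 : Real.Gamma (α / 2 + (((k + 1 : ℕ) : ℤ) : ℝ) + 1) =
      (α / 2 + k + 1) * Real.Gamma (α / 2 + k + 1) := by
    rw [← Real.Gamma_add_one hp.ne']
    push_cast
    ring_nf
  have e3 : α / 2 - (((k + 1 : ℕ) : ℤ) : ℝ) + 1 = α / 2 - k := by
    push_cast
    ring
  rw [e1, e2, e3, zpow_natCast, zpow_natCast, pow_succ]
  simp only [Int.cast_natCast]
  have h1 := (Real.Gamma_pos_of_pos hp).ne'
  rw [show (k : ℝ) - α / 2 = -(α / 2 - k) by ring, show (k : ℝ) + 1 + α / 2 = α / 2 + k + 1 by ring]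
  have h2 := hp.ne'
  generalize Real.Gamma (α / 2 - k) = X at *
  generalize Real.Gamma (α / 2 + k + 1) = Y at *
  generalize α / 2 - k = d at *
  generalize α / 2 + k + 1 = e at *
  -- At a pole of `Γ` both sides are `0`; otherwise `X` cancels.
  by_cases h0 : X = 0
  · simp [h0]
  field_simp

theorem g_zero (α : ℝ) : g α 0 = Real.Gamma (α + 1) / Real.Gamma (α / 2 + 1) ^ 2 := by
  simp [g, sq]

theorem g_zero_pos {α : ℝ} (hα : 0 < α) : 0 < g α 0 := by
  rw [g_zero]
  have := Real.Gamma_pos_of_pos (show 0 < α + 1 by linarith)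
  have := Real.Gamma_pos_of_pos (show 0 < α / 2 + 1 by linarith)
  positivity

theorem g_one {α : ℝ} (hα : 0 < α) : g α 1 = -(α / (α + 2)) * g α 0 := by
  have h := g_succ hα 0 (by simpa using hα.ne')
  simp only [Nat.zero_add, Nat.cast_one, Nat.cast_zero] at h
  rw [h]
  field_simp
  ring

theorem g_two {α : ℝ} (hα : 0 < α) (hα2 : α ≠ 2) :
    g α 2 = -(α * (2 - α) / ((α + 2) * (α + 4))) * g α 0 := by
  have h := g_succ hα 1 (by intro h; apply hα2; push_cast at h; linarith)
  simp only [Nat.reduceAdd, Nat.cast_one, Nat.cast_ofNat] at h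
  rw [h, g_one hα]
  field_simp
  ring

theorem g_neg_of_one_le {α : ℝ} (hα : 0 < α) (hα2 : α < 2) {k : ℕ} (hk : 1 ≤ k) :
    g α k < 0 := by
  induction k, hk using Nat.le_induction with
  | base =>
    rw [Nat.cast_one, g_one hα]
    have := g_zero_pos hα
    have : 0 < α / (α + 2) * g α 0 := by positivity
    linarith
  | succ k hk ih =>
    have hk' : (1 : ℝ) ≤ k := by exact_mod_cast hk
    rw [g_succ hα k (by linarith)]
    exact mul_neg_of_pos_of_neg (div_pos (by linarith) (by positivity)) ih

theorem g_two_eq_zero {k : ℕ} (hk : 2 ≤ k) : g 2 k = 0 := by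
  have : Real.Gamma ((2 : ℝ) / 2 - ((k : ℤ) : ℝ) + 1) = 0 := by
    rw [Real.Gamma_eq_zero_iff]
    refine ⟨k - 2, ?_⟩
    push_cast [Nat.cast_sub hk]
    ring
  unfold g
  rw [this]
  simp

theorem S_eq (α : ℝ) : S α = -g α 2 := by
  unfold S g
  norm_num
  ring_nf

theorem abs_g_succ {α : ℝ} (hα : 0 < α) (hα2 : α < 2) {k : ℕ} (hk : 1 ≤ k) :
    |g α ((k + 1 : ℕ) : ℤ)| = (1 - 2 * (α + 1) / (α + 2 * (k + 1))) * |g α k| := by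
  rw [abs_of_neg (g_neg_of_one_le hα hα2 hk), abs_of_neg (g_neg_of_one_le hα hα2 (by omega))]
  have hk' : (1 : ℝ) ≤ k := by exact_mod_cast hk
  rw [g_succ hα k (by linarith)]
  have : α + 2 * ((k : ℝ) + 1) ≠ 0 := by positivity
  have : (k : ℝ) + 1 + α / 2 ≠ 0 := by positivity
  field_simp
  ring

theorem abs_g_two {α : ℝ} (hα : 0 < α) (hα2 : α < 2) : |g α (2 : ℕ)| = S α := by
  rw [abs_of_neg (g_neg_of_one_le hα hα2 (by omega)), S_eq]
  rfl

theorem S_pos {α : ℝ} (hα : 0 < α) (hα2 : α < 2) : 0 < S α := by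
  rw [S_eq, neg_pos]
  exact g_neg_of_one_le (k := 2) hα hα2 (by omega)

/-! ### Pointwise bounds -/

/-- Strict form of Bernoulli's inequality for negative exponents. -/
theorem one_sub_mul_lt_one_add_rpow_neg {p t : ℝ} (hp : 0 < p) (ht : -1 < t) (ht0 : t ≠ 0) :
    1 - p * t < (1 + t) ^ (-p) := by
  have h1 : 0 < 1 + t := by linarith
  rw [Real.rpow_def_of_pos h1]
  have h2 := Real.log_lt_sub_one_of_pos h1 (by intro h; apply ht0; linarith)
  have h3 := Real.add_one_le_exp (Real.log (1 + t) * -p)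
  nlinarith

/-- With `x = 2p/y`, the left side is at most `exp(-2x)`, which is below `1 - x` for `0 < x ≤ 3/4`.
The value `3/4` is that of `x` at `p = α + 1`, `y = α + 6` (the step from `k = 2`) in the limit `α =
2`. -/
theorem one_sub_two_div_rpow_lt {p y : ℝ} (hp : 0 < p) (hy : 2 < y) (hpy : 8 * p ≤ 3 * y) :
    (1 - 2 / y) ^ (2 * p) < 1 - 2 * p / y := by
  have hy0 : 0 < y := by linarith
  have h1 : 0 < 1 - 2 / y := by rw [sub_pos, div_lt_one hy0]; exact hy
  set x := 2 * p / y with hx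
  have hx0 : 0 < x := by positivity
  have hx1 : x ≤ 3 / 4 := by rw [hx, div_le_iff₀ hy0]; linarith
  have h2 : (1 - 2 / y) ^ (2 * p) ≤ Real.exp (-(2 * x)) := by
    rw [Real.rpow_def_of_pos h1]
    apply Real.exp_le_exp.2
    have := Real.log_le_sub_one_of_pos h1
    calc Real.log (1 - 2 / y) * (2 * p) ≤ (-(2 / y)) * (2 * p) := by
          apply mul_le_mul_of_nonneg_right (by linarith) (by positivity)
      _ = -(2 * x) := by rw [hx]; ring
  refine h2.trans_lt ?_
  rw [Real.exp_neg, inv_lt_comm₀ (Real.exp_pos _) (by linarith)]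
  have h3 : ∑ i ∈ Finset.range 4, (2 * x) ^ i / (i.factorial : ℝ) ≤ Real.exp (2 * x) :=
    Real.sum_le_exp_of_nonneg (by positivity) 4
  refine lt_of_lt_of_le ?_ h3
  simp [Finset.sum_range_succ, Nat.factorial]
  rw [inv_lt_iff_one_lt_mul₀ (by linarith)]
  -- `(1 - x)` times the cubic Taylor polynomial of `exp(2x)` is `1 + x(1 - 2x²/3 - 4x³/3)`.
  have h4 : 0 < 1 - 2 / 3 * x ^ 2 - 4 / 3 * x ^ 3 := by
    have h5 : x ^ 2 ≤ (3 / 4) ^ 2 := by gcongr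
    have h6 : x ^ 3 ≤ (3 / 4) ^ 3 := by gcongr
    linarith
  nlinarith [mul_pos hx0 h4]

theorem one_sub_mul_div_lt {p y : ℝ} (hp : 0 < p) (hy : 0 < y) :
    1 - 2 * p / y < (y / (y + 2)) ^ p := by
  have h := one_sub_mul_lt_one_add_rpow_neg (t := 2 / y) hp (by linarith [div_pos two_pos hy])
    (by positivity)
  have e : y / (y + 2) = (1 + 2 / y)⁻¹ := by field_simp
  rw [e, Real.inv_rpow (by positivity), ← Real.rpow_neg (by positivity)]
  calc _ = 1 - p * (2 / y) := by ring
    _ < _ := h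

/-- Both bounds in (i) are equalities at `k = 2`; strictness appears with the first step. -/
theorem strict_of_weak_of_step {A B : ℕ → ℝ} {n : ℕ} (h0 : A n ≤ B n)
    (step : ∀ k, n ≤ k → A k ≤ B k → A (k + 1) < B (k + 1)) {k : ℕ} (hk : n < k) : A k < B k := by
  have weak : ∀ k, n ≤ k → A k ≤ B k := fun k hk =>
    Nat.le_induction h0 (fun k hk ih => (step k hk ih).le) k hk
  obtain ⟨j, rfl⟩ : ∃ j, k = j + 1 := ⟨k - 1, by omega⟩
  exact step j (by omega) (weak j (by omega))

theorem lower_lt_abs_g {α : ℝ} (hα : 1 < α) (hα2 : α < 2) {k : ℕ} (hk : 2 < k) :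
    S α * ((α + 4) / (α + 2 * (k : ℝ))) ^ (2 * (α + 1)) < |g α k| := by
  have hα0 : 0 < α := by linarith
  have hS := S_pos hα0 hα2
  refine strict_of_weak_of_step (n := 2)
    (A := fun k : ℕ => S α * ((α + 4) / (α + 2 * (k : ℝ))) ^ (2 * (α + 1)))
    (B := fun k : ℕ => |g α k|) ?_ ?_ hk
  · have : α + 4 ≠ 0 := by linarith
    simp only [abs_g_two hα0 hα2]
    norm_num [div_self this]
  · intro k hk ih
    have hk' : (2 : ℝ) ≤ k := by exact_mod_cast hk
    rw [abs_g_succ hα0 hα2 (by omega)]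
    have h1 := one_sub_two_div_rpow_lt (p := α + 1) (y := α + 2 * (k + 1)) (by linarith)
      (by linarith) (by linarith)
    have e : (α + 4) / (α + 2 * ((k + 1 : ℕ) : ℝ)) =
        (1 - 2 / (α + 2 * (k + 1))) * ((α + 4) / (α + 2 * k)) := by
      push_cast
      field_simp
      ring
    have h2 : 0 ≤ 1 - 2 / (α + 2 * ((k : ℝ) + 1)) := by
      rw [sub_nonneg, div_le_one (by positivity)]
      linarith
    rw [e, Real.mul_rpow h2 (by positivity), mul_left_comm]
    exact mul_lt_mul h1 ih (by positivity) (le_trans (by positivity) h1.le)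

theorem abs_g_lt_upper {α : ℝ} (hα : 1 < α) (hα2 : α < 2) {k : ℕ} (hk : 2 < k) :
    |g α k| < S α * ((α + 6) / (α + 2 * ((k : ℝ) + 1))) ^ (α + 1) := by
  have hα0 : 0 < α := by linarith
  have hS := S_pos hα0 hα2
  refine strict_of_weak_of_step (n := 2)
    (B := fun k : ℕ => S α * ((α + 6) / (α + 2 * ((k : ℝ) + 1))) ^ (α + 1))
    (A := fun k : ℕ => |g α k|) ?_ ?_ hk
  · have : α + 6 ≠ 0 := by linarith
    simp only [abs_g_two hα0 hα2]
    norm_num [div_self this]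
  · intro k hk ih
    have hk' : (2 : ℝ) ≤ k := by exact_mod_cast hk
    rw [abs_g_succ hα0 hα2 (by omega)]
    have h1 := one_sub_mul_div_lt (p := α + 1) (y := α + 2 * (k + 1)) (by linarith) (by linarith)
    have e : (α + 6) / (α + 2 * (((k + 1 : ℕ) : ℝ) + 1)) =
        ((α + 2 * (k + 1)) / (α + 2 * (k + 1) + 2)) * ((α + 6) / (α + 2 * (k + 1))) := by
      push_cast
      field_simp
      ring
    rw [e, Real.mul_rpow (by positivity) (by positivity), mul_left_comm]
    refine mul_lt_mul h1 ih (abs_pos.2 (g_neg_of_one_le hα0 hα2 (by omega)).ne) (by positivity)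

/-! ### Telescoping bounds for finite sums and tails -/

theorem rpow_neg_sub_lt {q x : ℝ} (hq : 0 < q) (hx : 0 < x) :
    x ^ (-q) - (x + 2) ^ (-q) < 2 * q * x ^ (-(q + 1)) := by
  have h := one_sub_mul_lt_one_add_rpow_neg (t := 2 / x) hq (by linarith [div_pos two_pos hx])
    (by positivity)
  have e : x + 2 = x * (1 + 2 / x) := by field_simp
  rw [e, Real.mul_rpow hx.le (by positivity), neg_add, ← sub_eq_add_neg, Real.rpow_sub_one hx.ne']
  have := mul_lt_mul_of_pos_left h (Real.rpow_pos_of_pos hx (-q))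
  calc _ < x ^ (-q) - x ^ (-q) * (1 - q * (2 / x)) := by linarith
    _ = _ := by ring

/-- Bernoulli based at `x + 2` instead of `x`. -/
theorem lt_rpow_neg_sub {q x : ℝ} (hq : 0 < q) (hx : 0 < x) :
    2 * q * (x + 2) ^ (-(q + 1)) < x ^ (-q) - (x + 2) ^ (-q) := by
  have hy : 0 < x + 2 := by linarith
  have h0 : -1 < -(2 / (x + 2)) := by rw [neg_lt_neg_iff, div_lt_one hy]; linarith
  have h := one_sub_mul_lt_one_add_rpow_neg (t := -(2 / (x + 2))) hq h0
    (neg_ne_zero.2 (by positivity))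
  have e : x ^ (-q) = ((x + 2) * (1 + -(2 / (x + 2)))) ^ (-q) := by
    congr 1
    field_simp
    ring
  rw [e, Real.mul_rpow hy.le (by linarith), neg_add, ← sub_eq_add_neg, Real.rpow_sub_one hy.ne']
  have := mul_lt_mul_of_pos_left h (Real.rpow_pos_of_pos hy (-q))
  calc _ = (x + 2) ^ (-q) * (1 - q * -(2 / (x + 2))) - (x + 2) ^ (-q) := by ring
    _ < _ := by linarith

theorem lower_telescope_lt_abs_g {α : ℝ} (hα : 1 < α) (hα2 : α < 2) {k : ℕ} (hk : 3 ≤ k) :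
    S α * ((α + 4) ^ (2 * (α + 1)) / (2 * (2 * α + 1))) *
      ((α + 2 * k) ^ (-(2 * α + 1)) - (α + 2 * ((k + 1 : ℕ) : ℝ)) ^ (-(2 * α + 1))) < |g α k| := by
  have hS := S_pos (by linarith) hα2
  refine lt_trans ?_ (lower_lt_abs_g hα hα2 hk)
  have hx : 0 < α + 2 * (k : ℝ) := by positivity
  have h := rpow_neg_sub_lt (q := 2 * α + 1) (by linarith) hx
  have h4 : 0 < α + 4 := by linarith
  rw [Real.div_rpow h4.le hx.le, mul_assoc]
  refine mul_lt_mul_of_pos_left ?_ hS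
  rw [show α + 2 * ((k + 1 : ℕ) : ℝ) = α + 2 * k + 2 by push_cast; ring]
  have hc : 0 < (α + 4) ^ (2 * (α + 1)) / (2 * (2 * α + 1)) := by positivity
  refine (mul_lt_mul_of_pos_left h hc).trans_eq ?_
  rw [show 2 * α + 1 + 1 = 2 * (α + 1) by ring, Real.rpow_neg hx.le]
  field_simp

theorem abs_g_lt_upper_telescope {α : ℝ} (hα : 1 < α) (hα2 : α < 2) {k : ℕ} (hk : 3 ≤ k) :
    |g α k| < S α * ((α + 6) ^ (α + 1) / (2 * α)) *
      ((α + 2 * k) ^ (-α) - (α + 2 * ((k + 1 : ℕ) : ℝ)) ^ (-α)) := by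
  have hS := S_pos (by linarith) hα2
  refine lt_trans (abs_g_lt_upper hα hα2 hk) ?_
  have hx : 0 < α + 2 * (k : ℝ) := by positivity
  have h := lt_rpow_neg_sub (q := α) (by linarith) hx
  have h6 : 0 < α + 6 := by linarith
  have hy : 0 < α + 2 * (k : ℝ) + 2 := by linarith
  rw [show α + 2 * ((k : ℝ) + 1) = α + 2 * k + 2 by ring, Real.div_rpow h6.le hy.le, mul_assoc]
  refine mul_lt_mul_of_pos_left ?_ hS
  rw [show α + 2 * ((k + 1 : ℕ) : ℝ) = α + 2 * k + 2 by push_cast; ring]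
  have hc : 0 < (α + 6) ^ (α + 1) / (2 * α) := by positivity
  refine lt_of_eq_of_lt ?_ (mul_lt_mul_of_pos_left h hc)
  rw [Real.rpow_neg hy.le]
  field_simp

theorem sum_Icc_telescope (F : ℕ → ℝ) {n m : ℕ} (h : n ≤ m) :
    ∑ k ∈ Finset.Icc n m, (F k - F (k + 1)) = F n - F (m + 1) := by
  rw [← Finset.Ico_add_one_right_eq_Icc]
  have := Finset.sum_Ico_sub (fun k => -F k) (show n ≤ m + 1 by omega)
  simp only [neg_sub_neg] at this
  rw [this]

theorem hasSum_telescope {F : ℕ → ℝ} (hF : Antitone F) (h0 : Tendsto F atTop (𝓝 0)) :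
    HasSum (fun j => F j - F (j + 1)) (F 0) := by
  rw [hasSum_iff_tendsto_nat_of_nonneg fun j => sub_nonneg.2 (hF (Nat.le_succ j))]
  simp only [Finset.sum_range_sub']
  simpa using h0.const_sub (F 0)

/-- The tail of the natural numbers from `n` on, enumerated by all natural numbers. -/
def natEquivTail (n : ℕ) : ℕ ≃ {k : ℕ // n ≤ k} where
  toFun j := ⟨n + j, Nat.le_add_right n j⟩
  invFun k := k - n
  left_inv j := by simp
  right_inv k := Subtype.ext (Nat.add_sub_cancel' k.2)

theorem hasSum_tail_telescope {α q : ℝ} (hα : 0 < α) (hq : 0 < q) (n : ℕ) :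
    HasSum (fun j : ℕ => (α + 2 * ((n + j : ℕ) : ℝ)) ^ (-q) -
      (α + 2 * ((n + j + 1 : ℕ) : ℝ)) ^ (-q)) ((α + 2 * n) ^ (-q)) := by
  have h := hasSum_telescope (F := fun j : ℕ => (α + 2 * ((n + j : ℕ) : ℝ)) ^ (-q)) ?_ ?_
  · simpa [add_assoc] using h
  · intro i j hij
    refine Real.rpow_le_rpow_of_nonpos (by positivity) ?_ (by linarith)
    have : (i : ℝ) ≤ j := by exact_mod_cast hij
    push_cast
    linarith
  · refine (tendsto_rpow_neg_atTop hq).comp ?_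
    refine tendsto_atTop_mono (fun j => ?_) tendsto_natCast_atTop_atTop
    push_cast
    have : (0 : ℝ) ≤ j := by positivity
    have : (0 : ℝ) ≤ n := by positivity
    linarith

theorem sum_Icc_bounds {α : ℝ} (hα : 1 < α) (hα2 : α < 2) {n m : ℕ} (hn : 3 ≤ n) (hnm : n ≤ m) :
    P₁ m n α * ((α + 4) ^ (2 * (α + 1)) / (2 * (2 * α + 1))) <
        ∑ k ∈ Finset.Icc n m, |g α (k : ℤ)| ∧
      ∑ k ∈ Finset.Icc n m, |g α (k : ℤ)| < P₂ m n α * ((α + 6) ^ (α + 1) / (2 * α)) := by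
  have hne : (Finset.Icc n m).Nonempty := Finset.nonempty_Icc.2 hnm
  have key : ∀ q : ℝ, ∑ k ∈ Finset.Icc n m,
      ((α + 2 * (k : ℝ)) ^ (-q) - (α + 2 * ((k + 1 : ℕ) : ℝ)) ^ (-q)) =
      (α + 2 * n) ^ (-q) - (α + 2 * m + 2) ^ (-q) := fun q => by
    rw [sum_Icc_telescope (fun k : ℕ => (α + 2 * (k : ℝ)) ^ (-q)) hnm]
    push_cast
    ring_nf
  constructor
  · have h := Finset.sum_lt_sum_of_nonempty hne fun k hk =>
      lower_telescope_lt_abs_g hα hα2 (hn.trans (Finset.mem_Icc.1 hk).1)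
    rw [← Finset.mul_sum, key] at h
    rw [P₁, mul_right_comm]
    exact h
  · have h := Finset.sum_lt_sum_of_nonempty hne fun k hk =>
      abs_g_lt_upper_telescope hα hα2 (hn.trans (Finset.mem_Icc.1 hk).1)
    rw [← Finset.mul_sum, key] at h
    rw [P₂, mul_right_comm]
    exact h

theorem tail_bounds {α : ℝ} (hα : 1 < α) (hα2 : α < 2) {n : ℕ} (hn : 3 ≤ n) :
    Summable (fun k : {k : ℕ // n ≤ k} => |g α ((k : ℕ) : ℤ)|) ∧
      Q₁ n α * ((α + 4) ^ (2 * (α + 1)) / (2 * (2 * α + 1))) <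
        ∑' k : {k : ℕ // n ≤ k}, |g α ((k : ℕ) : ℤ)| ∧
      ∑' k : {k : ℕ // n ≤ k}, |g α ((k : ℕ) : ℤ)| < Q₂ n α * ((α + 6) ^ (α + 1) / (2 * α)) := by
  have hα0 : 0 < α := by linarith
  rw [← (natEquivTail n).summable_iff, ← (natEquivTail n).tsum_eq]
  have hlow := (hasSum_tail_telescope hα0 (show 0 < 2 * α + 1 by linarith) n).mul_left
    (S α * ((α + 4) ^ (2 * (α + 1)) / (2 * (2 * α + 1))))
  have hup := (hasSum_tail_telescope hα0 hα0 n).mul_left (S α * ((α + 6) ^ (α + 1) / (2 * α)))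
  have hl (j : ℕ) := lower_telescope_lt_abs_g hα hα2 (k := n + j) (by omega)
  have hu (j : ℕ) := abs_g_lt_upper_telescope hα hα2 (k := n + j) (by omega)
  have hs : Summable fun j : ℕ => |g α ((n + j : ℕ) : ℤ)| :=
    .of_nonneg_of_le (fun _ => abs_nonneg _) (fun j => (hu j).le) hup.summable
  have hx : 0 ≤ α + 2 * (n : ℝ) := by positivity
  refine ⟨hs, ?_, ?_⟩
  · have := hasSum_lt (fun j => (hl j).le) (hl 0) hlow hs.hasSum
    rw [Real.rpow_neg hx] at this
    rw [Q₁, div_mul_eq_mul_div, div_eq_mul_inv]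
    exact this
  · have := hasSum_lt (fun j => (hu j).le) (hu 0) hs.hasSum hup
    rw [Real.rpow_neg hx] at this
    rw [Q₂, div_mul_eq_mul_div, div_eq_mul_inv]
    exact this

/-! ### The two-sided sum equals `g_0` -/

theorem hasSum_abs_g_succ {α : ℝ} (hα : 1 < α) (hα2 : α < 2) :
    HasSum (fun j : ℕ => |g α ((j + 1 : ℕ) : ℤ)|) (g α 0 / 2) := by
  have hα0 : 0 < α := by linarith
  -- The weight `c_k = (k + α/2)/α` turns the recurrence into `|g_k| = c_k|g_k| - c_{k+1}|g_{k+1}|`;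
  -- the sum is `c_1|g_1| = g_0/2`.
  have step : ∀ k : ℕ, 1 ≤ k → |g α k| = (k + α / 2) / α * |g α k| -
      (((k + 1 : ℕ) : ℝ) + α / 2) / α * |g α ((k + 1 : ℕ) : ℤ)| := fun k hk => by
    rw [abs_g_succ hα0 hα2 hk]
    have : α + 2 * ((k : ℝ) + 1) ≠ 0 := by positivity
    push_cast
    field_simp
    ring
  have h := hasSum_telescope
    (F := fun j : ℕ => (((j + 1 : ℕ) : ℝ) + α / 2) / α * |g α ((j + 1 : ℕ) : ℤ)|) ?_ ?_
  · convert h using 1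
    · ext j
      exact step (j + 1) (by omega)
    · have h1 : |g α ((0 + 1 : ℕ) : ℤ)| = α / (α + 2) * g α 0 := by
        rw [abs_of_neg (g_neg_of_one_le hα0 hα2 (by omega))]
        simp only [zero_add, Nat.cast_one, g_one hα0]
        ring
      rw [h1]
      push_cast
      field_simp
      ring
  · refine antitone_nat_of_succ_le fun j => ?_
    rw [← sub_nonneg, ← step (j + 1) (by omega)]
    exact abs_nonneg _
  -- The shift reaches `k ≥ 3`, where the upper bound in (i) gives `c_k|g_k| = O(k^(-α))`.
  · rw [← tendsto_add_atTop_iff_nat 2]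
    have hlim : Tendsto (fun j : ℕ => S α * (α + 6) ^ (α + 1) / α *
        (α + 2 * ((j : ℝ) + 4)) ^ (-α)) atTop (𝓝 0) := by
      rw [← mul_zero (S α * (α + 6) ^ (α + 1) / α)]
      refine ((tendsto_rpow_neg_atTop hα0).comp ?_).const_mul _
      refine tendsto_atTop_mono (fun j => ?_) tendsto_natCast_atTop_atTop
      have : (0 : ℝ) ≤ j := by positivity
      linarith
    refine squeeze_zero (fun j => by positivity) (fun j => ?_) hlim
    have hu := (abs_g_lt_upper hα hα2 (k := j + 2 + 1) (by omega)).le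
    have hy : 0 < α + 2 * ((j : ℝ) + 4) := by positivity
    rw [show α + 2 * (((j + 2 + 1 : ℕ) : ℝ) + 1) = α + 2 * (j + 4) by push_cast; ring,
      Real.div_rpow (by linarith) hy.le] at hu
    have hS := S_pos hα0 hα2
    calc _ ≤ (α + 2 * ((j : ℝ) + 4)) / α * (S α * ((α + 6) ^ (α + 1) /
          (α + 2 * ((j : ℝ) + 4)) ^ (α + 1))) := by
          refine mul_le_mul ?_ hu (abs_nonneg _) (by positivity)
          refine div_le_div_of_nonneg_right ?_ hα0.le
          push_cast
          have : (0 : ℝ) ≤ j := by positivity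
          linarith
      _ = _ := by
          rw [Real.rpow_neg hy.le, Real.rpow_add_one hy.ne' α]
          field_simp

theorem hasSum_abs_g_ne_zero {α : ℝ} (hα : 1 < α) (hα2 : α < 2) :
    HasSum (fun k : {k : ℤ // k ≠ 0} => |g α (k : ℤ)|) (g α 0) := by
  have h := hasSum_abs_g_succ hα hα2
  change HasSum ((fun k : ℤ => |g α k|) ∘ ((↑) : {k : ℤ | k ≠ 0} → ℤ)) _
  rw [hasSum_subtype_iff_indicator, ← add_halves (g α 0)]
  refine HasSum.of_nat_of_neg_add_one ?_ ?_
  · rw [← hasSum_nat_add_iff' 1, Finset.sum_range_one, Set.indicator_of_notMem (by simp), sub_zero]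
    refine cast (congrArg (HasSum · (g α 0 / 2)) (funext fun j => ?_)) h
    symm
    rw [Set.indicator_of_mem]
    simp only [Set.mem_ofPred_eq]
    omega
  · convert h using 1
    ext j
    rw [Set.indicator_of_mem, g_neg]
    · push_cast
      rfl
    · simp only [Set.mem_ofPred_eq]
      omega

/-! ### The Gamma ratio `V` and bounds for `g_0` -/

/-- `V x = Γ(x) Γ(x+1) / Γ(x+1/2)²`. -/
noncomputable def V (x : ℝ) : ℝ := Real.Gamma x * Real.Gamma (x + 1) / Real.Gamma (x + 1 / 2) ^ 2

theorem V_pos {x : ℝ} (hx : 0 < x) : 0 < V x := by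
  have := Real.Gamma_pos_of_pos hx
  have := Real.Gamma_pos_of_pos (show 0 < x + 1 by linarith)
  have := Real.Gamma_pos_of_pos (show 0 < x + 1 / 2 by linarith)
  unfold V
  positivity

/-- In Euler's limit for each `Γ`, the factorials and the powers of `n` cancel, since `x + (x+1) =
2(x + 1/2)`. -/
theorem tendsto_prod_V {x : ℝ} (hx : 0 < x) :
    Tendsto (fun n : ℕ => ∏ j ∈ Finset.range (n + 1),
      ((x + 1 / 2 + j) ^ 2 / ((x + j) * (x + 1 + j)))) atTop (𝓝 (V x)) := by
  have h := ((Real.GammaSeq_tendsto_Gamma x).mul (Real.GammaSeq_tendsto_Gamma (x + 1))).div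
    ((Real.GammaSeq_tendsto_Gamma (x + 1 / 2)).pow 2)
    (pow_ne_zero 2 (Real.Gamma_pos_of_pos (by linarith)).ne')
  refine h.congr' ?_
  filter_upwards [eventually_gt_atTop 0] with n hn
  have hn' : (0 : ℝ) < n := by exact_mod_cast hn
  have e : (n : ℝ) ^ x * (n : ℝ) ^ (x + 1) = ((n : ℝ) ^ (x + 1 / 2)) ^ 2 := by
    rw [← Real.rpow_add hn', ← Real.rpow_natCast, ← Real.rpow_mul hn'.le]
    congr 1
    push_cast
    ring
  have hp : ∀ y : ℝ, 0 < y → ∏ j ∈ Finset.range (n + 1), (y + (j : ℝ)) ≠ 0 := fun y hy =>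
    Finset.prod_ne_zero_iff.2 fun j _ => by positivity
  simp only [Pi.div_apply, Real.GammaSeq, Finset.prod_div_distrib,
    Finset.prod_mul_distrib, Finset.prod_pow]
  have h1 := hp x hx
  have h2 := hp (x + 1) (by linarith)
  have h3 := hp (x + 1 / 2) (by linarith)
  have h4 : (n.factorial : ℝ) ≠ 0 := by positivity
  have h5 : (n : ℝ) ^ (x + 1 / 2) ≠ 0 := by positivity
  generalize ∏ j ∈ Finset.range (n + 1), (x + (j : ℝ)) = A at *
  generalize ∏ j ∈ Finset.range (n + 1), (x + 1 + (j : ℝ)) = B at *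
  generalize ∏ j ∈ Finset.range (n + 1), (x + 1 / 2 + (j : ℝ)) = C at *
  generalize (n : ℝ) ^ (x + 1 / 2) = D at *
  generalize (n : ℝ) ^ (x + 1) = E at *
  generalize (n : ℝ) ^ x = F at *
  generalize (n.factorial : ℝ) = G at *
  rw [div_mul_div_comm, div_pow, div_div_div_eq, mul_mul_mul_comm, e]
  field_simp

theorem V_antitoneOn : AntitoneOn V (Set.Ioi 0) := by
  intro x hx y hy hxy
  rw [Set.mem_Ioi] at hx hy
  refine le_of_tendsto_of_tendsto' (tendsto_prod_V hy) (tendsto_prod_V hx) fun n => ?_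
  refine Finset.prod_le_prod (fun j _ => by positivity) fun j _ => ?_
  -- In this form each factor visibly decreases in `z`.
  have key : ∀ z : ℝ, 0 < z → (z + 1 / 2 + j) ^ 2 / ((z + j) * (z + 1 + j)) =
      1 + 1 / 4 / ((z + j) * (z + 1 + j)) := fun z hz => by
    field_simp
    ring
  rw [key x hx, key y hy]
  gcongr

theorem V_one : V 1 = 4 / Real.pi := by
  have h : Real.Gamma (1 + 1 / 2) = √Real.pi / 2 := by
    rw [add_comm, Real.Gamma_add_one (by norm_num), Real.Gamma_one_half_eq]
    ring
  have h2 : Real.Gamma (1 + 1) = 1 := by rw [Real.Gamma_add_one one_ne_zero, Real.Gamma_one, mul_one]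
  rw [V, h, h2, Real.Gamma_one, div_pow, Real.sq_sqrt Real.pi_pos.le]
  field_simp
  norm_num

theorem V_three_halves : V (3 / 2) = 3 * Real.pi / 8 := by
  have h : Real.Gamma (3 / 2) = √Real.pi / 2 := by
    rw [show (3 / 2 : ℝ) = 1 / 2 + 1 by norm_num, Real.Gamma_add_one (by norm_num),
      Real.Gamma_one_half_eq]
    ring
  have h2 : Real.Gamma (3 / 2 + 1 / 2) = 1 := by
    rw [show (3 / 2 + 1 / 2 : ℝ) = 1 + 1 by norm_num, Real.Gamma_add_one one_ne_zero,
      Real.Gamma_one, mul_one]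
  rw [V, h2, Real.Gamma_add_one (by norm_num), h]
  have := Real.sq_sqrt Real.pi_pos.le
  linear_combination (3 / 8) * this

theorem four_rpow (α : ℝ) : (4 : ℝ) ^ α = (2 ^ α) ^ 2 := by
  rw [← Real.rpow_mul_natCast two_pos.le, mul_comm, Real.rpow_mul two_pos.le]
  norm_num

theorem g_zero_sq {α : ℝ} (hα : 0 < α) :
    g α 0 ^ 2 = 4 ^ α / Real.pi * V ((α + 1) / 2) * (2 / (α + 1)) := by
  have h := Real.Gamma_mul_Gamma_add_half ((α + 1) / 2)
  have hs : 0 < (α + 1) / 2 := by linarith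
  have e1 : (α + 1) / 2 + 1 / 2 = α / 2 + 1 := by ring
  have e2 : 2 * ((α + 1) / 2) = α + 1 := by ring
  rw [e1, e2, show 1 - (α + 1) = -α by ring, Real.rpow_neg two_pos.le] at h
  rw [g_zero, V, e1, Real.Gamma_add_one hs.ne', four_rpow]
  have hG1 := Real.Gamma_pos_of_pos hs
  have hG2 := Real.Gamma_pos_of_pos (show 0 < α / 2 + 1 by linarith)
  have hπ := Real.sq_sqrt Real.pi_pos.le
  have hπ0 := Real.sqrt_pos.2 Real.pi_pos
  have h2 : (0 : ℝ) < 2 ^ α := by positivity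
  generalize Real.Gamma ((α + 1) / 2) = X at *
  generalize Real.Gamma (α / 2 + 1) = Y at *
  generalize (2 : ℝ) ^ α = T at *
  rw [← hπ]
  have h' : Real.Gamma (α + 1) = X * Y * T / √Real.pi := by
    rw [h]
    field_simp
  rw [h']
  field_simp

theorem g_zero_bounds {α : ℝ} (hα : 1 < α) (hα2 : α < 2) :
    (2 : ℝ) ^ (1 + α) / ((1 + α) * Real.pi) ≤ g α 0 ∧ g α 0 ≤ (2 : ℝ) ^ (1 + α) / Real.pi := by
  have h0 := g_zero_pos (show 0 < α by linarith)
  have hsq := g_zero_sq (show 0 < α by linarith)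
  have hπ := Real.pi_gt_three
  have hs : (0 : ℝ) < (α + 1) / 2 := by linarith
  have hV1 : V ((α + 1) / 2) ≤ 4 / Real.pi := by
    rw [← V_one]
    exact V_antitoneOn (Set.mem_Ioi.2 one_pos) hs (by linarith)
  have hV2 : 3 * Real.pi / 8 ≤ V ((α + 1) / 2) := by
    rw [← V_three_halves]
    exact V_antitoneOn hs (Set.mem_Ioi.2 (by norm_num)) (by linarith)
  rw [Real.rpow_add two_pos, Real.rpow_one]
  rw [four_rpow] at hsq
  have hT : (0 : ℝ) < 2 ^ α := by positivity
  generalize (2 : ℝ) ^ α = T at *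
  constructor
  · refine le_of_sq_le_sq ?_ h0.le
    rw [hsq]
    have h1 : T ^ 2 / Real.pi * (3 * Real.pi / 8) * (2 / (α + 1)) ≤
        T ^ 2 / Real.pi * V ((α + 1) / 2) * (2 / (α + 1)) := by gcongr
    refine le_trans ?_ h1
    rw [div_pow, div_le_iff₀ (by positivity)]
    have e : T ^ 2 / Real.pi * (3 * Real.pi / 8) * (2 / (α + 1)) * ((1 + α) * Real.pi) ^ 2 =
        T ^ 2 * (3 / 4 * (1 + α) * Real.pi ^ 2) := by
      have : α + 1 ≠ 0 := by linarith
      field_simp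
      ring
    rw [e, mul_pow, mul_comm]
    gcongr
    nlinarith
  · refine le_of_sq_le_sq ?_ (by positivity)
    rw [hsq]
    have h1 : T ^ 2 / Real.pi * V ((α + 1) / 2) * (2 / (α + 1)) ≤
        T ^ 2 / Real.pi * (4 / Real.pi) * 1 := by
      gcongr
      rw [div_le_one (by linarith)]
      linarith
    refine h1.trans_eq ?_
    field_simp
    ring

/-! ### Monotonicity in the order -/

theorem g_zero_strictMono {a b : ℝ} (ha : 0 < a) (hab : a < b) : g a 0 < g b 0 := by
  -- Convexity of `log Γ` yields only weak monotonicity; shifting the arguments by one splits off a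
  -- strictly increasing rational factor.
  have key : ∀ x : ℝ, 0 < x → g x 0 =
      Real.Gamma (x + 2) / Real.Gamma (x / 2 + 2) ^ 2 * ((x / 2 + 1) ^ 2 / (x + 1)) := fun x hx => by
    have h1 := (Real.Gamma_pos_of_pos (show 0 < x / 2 + 1 by linarith)).ne'
    rw [g_zero, show x + 2 = x + 1 + 1 by ring, show x / 2 + 2 = x / 2 + 1 + 1 by ring,
      Real.Gamma_add_one (show x + 1 ≠ 0 by linarith),
      Real.Gamma_add_one (show x / 2 + 1 ≠ 0 by linarith)]
    have : x + 1 ≠ 0 := by linarith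
    have : x / 2 + 1 ≠ 0 := by linarith
    generalize Real.Gamma (x / 2 + 1) = Y at *
    generalize x / 2 + 1 = e at *
    field_simp
  have hb : 0 < b := ha.trans hab
  have G : ∀ {x : ℝ}, 0 < x → 0 < Real.Gamma x := Real.Gamma_pos_of_pos
  have hweak : Real.Gamma (a + 2) / Real.Gamma (a / 2 + 2) ^ 2 ≤
      Real.Gamma (b + 2) / Real.Gamma (b / 2 + 2) ^ 2 := by
    have c := Real.convexOn_log_Gamma
    have m1 : a / 2 + 2 ∈ Set.Ioi (0 : ℝ) := Set.mem_Ioi.2 (by linarith)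
    have m2 : b / 2 + 2 ∈ Set.Ioi (0 : ℝ) := Set.mem_Ioi.2 (by linarith)
    have m3 : a + 2 ∈ Set.Ioi (0 : ℝ) := Set.mem_Ioi.2 (by linarith)
    have m4 : b + 2 ∈ Set.Ioi (0 : ℝ) := Set.mem_Ioi.2 (by linarith)
    -- The slopes over `[a/2+2, b/2+2]` and `[a+2, b+2]` are compared through the chord over
    -- `[a/2+2, b+2]`.
    have s1 := c.secant_mono m1 m2 m4 (by linarith) (by linarith) (by linarith)
    have s2 := c.secant_mono m4 m1 m3 (by linarith) (by linarith) (by linarith)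
    rw [← neg_div_neg_eq, neg_sub, neg_sub] at s2
    have s3 := s1.trans s2
    rw [← neg_div_neg_eq (_ - _) (a + 2 - _), neg_sub, neg_sub,
      div_le_div_iff₀ (by linarith) (by linarith)] at s3
    simp only [Function.comp_apply] at s3
    have s4 : 2 * (Real.log (Real.Gamma (b / 2 + 2)) - Real.log (Real.Gamma (a / 2 + 2))) ≤
        Real.log (Real.Gamma (b + 2)) - Real.log (Real.Gamma (a + 2)) := by
      have : 0 < (b - a) / 2 := by linarith
      refine le_of_mul_le_mul_right ?_ this
      linarith
    have g1 := G m1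
    have g2 := G m2
    have g3 := G m3
    have g4 := G m4
    rw [← Real.log_le_log_iff (by positivity) (by positivity), Real.log_div g3.ne' (by positivity),
      Real.log_div g4.ne' (by positivity), Real.log_pow, Real.log_pow]
    push_cast
    linarith
  rw [key a ha, key b hb]
  have g2 := G (show 0 < b / 2 + 2 by linarith)
  have g4 := G (show 0 < b + 2 by linarith)
  refine mul_lt_mul' hweak ?_ (by positivity) (by positivity)
  rw [div_lt_div_iff₀ (by linarith) (by linarith)]
  nlinarith [mul_pos ha hb, mul_pos (mul_pos ha hb) (sub_pos.2 hab),
    mul_pos (sub_pos.2 hab) (add_pos ha hb)]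

theorem log_elementary_factor_strictAntiOn :
    StrictAntiOn (fun x : ℝ => x * Real.log 4 + 2 * Real.log x + 2 * Real.log (2 - x)
      - 2 * Real.log (x + 2) - 2 * Real.log (x + 4) - Real.log (x + 1)) (Set.Ico 1 2) := by
  have hd : ∀ x : ℝ, 1 ≤ x → x < 2 → HasDerivAt
      (fun x : ℝ => x * Real.log 4 + 2 * Real.log x + 2 * Real.log (2 - x)
      - 2 * Real.log (x + 2) - 2 * Real.log (x + 4) - Real.log (x + 1))
      (1 * Real.log 4 + 2 * (1 / x) + 2 * (-1 / (2 - x)) - 2 * (1 / (x + 2)) - 2 * (1 / (x + 4))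
        - 1 / (x + 1)) x := fun x h1 h2 => by
    have i := hasDerivAt_id' x
    exact ((((((i.mul_const _).add ((i.log (by linarith)).const_mul 2)).add
      (((i.const_sub 2).log (by linarith)).const_mul 2)).sub
      (((i.add_const 2).log (by linarith)).const_mul 2)).sub
      (((i.add_const 4).log (by linarith)).const_mul 2))).sub ((i.add_const 1).log (by linarith))
  refine strictAntiOn_of_deriv_neg (convex_Ico 1 2)
    (fun x hx => (hd x hx.1 hx.2).continuousAt.continuousWithinAt) fun x hx => ?_
  rw [interior_Ico] at hx
  obtain ⟨h1, h2⟩ := hx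
  rw [(hd x h1.le h2).deriv]
  have hlog : Real.log 4 < 1.3863 := by
    rw [show (4 : ℝ) = 2 ^ 2 by norm_num, Real.log_pow]
    have := Real.log_two_lt_d9
    push_cast
    linarith
  -- This uses `x(2 - x) ≤ 1`; the next three bounds are tangent lines at `x = 1`. There the
  -- derivative is `log 4 - 2/3 - 2/5 - 1/2 < 0`.
  have b1 : 1 / x + -1 / (2 - x) ≤ -2 * (x - 1) := by
    rw [div_add_div _ _ (by linarith) (by linarith), div_le_iff₀ (by nlinarith)]
    nlinarith [mul_nonneg (sub_nonneg.2 h1.le) (sq_nonneg (x - 1))]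
  have b2 : 1 / 3 - (x - 1) / 9 ≤ 1 / (x + 2) := by
    rw [le_div_iff₀ (by linarith)]
    nlinarith [sq_nonneg (x - 1)]
  have b3 : 1 / 5 - (x - 1) / 25 ≤ 1 / (x + 4) := by
    rw [le_div_iff₀ (by linarith)]
    nlinarith [sq_nonneg (x - 1)]
  have b4 : 1 / 2 - (x - 1) / 4 ≤ 1 / (x + 1) := by
    rw [le_div_iff₀ (by linarith)]
    nlinarith [sq_nonneg (x - 1)]
  linarith

theorem abs_g_two_sq {α : ℝ} (hα : 0 < α) (hα2 : α < 2) :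
    |g α (2 : ℕ)| ^ 2 = 2 / Real.pi * V ((α + 1) / 2) *
      Real.exp (α * Real.log 4 + 2 * Real.log α + 2 * Real.log (2 - α)
      - 2 * Real.log (α + 2) - 2 * Real.log (α + 4) - Real.log (α + 1)) := by
  have h2 : 0 < 2 - α := by linarith
  have h3 : 0 < α + 2 := by linarith
  have h4 : 0 < α + 4 := by linarith
  have h5 : 0 < α + 1 := by linarith
  have hsq : ∀ x : ℝ, 0 < x → Real.exp (2 * Real.log x) = x ^ 2 := fun x hx => by
    rw [mul_comm, Real.exp_mul, Real.exp_log hx]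
    norm_cast
  rw [sq_abs, Nat.cast_ofNat, g_two hα hα2.ne, mul_pow, g_zero_sq hα]
  simp only [Real.exp_sub, Real.exp_add]
  rw [hsq α hα, hsq _ h2, hsq _ h3, hsq _ h4, Real.exp_log h5, mul_comm α (Real.log 4), ← Real.rpow_def_of_pos
    four_pos]
  field_simp

theorem abs_g_two_strictAnti {a b : ℝ} (ha : 1 ≤ a) (hab : a < b) (hb : b < 2) :
    |g b (2 : ℕ)| < |g a (2 : ℕ)| := by
  refine lt_of_pow_lt_pow_left₀ 2 (abs_nonneg _) ?_
  rw [abs_g_two_sq (by linarith) hb, abs_g_two_sq (by linarith) (by linarith)]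
  have hV := V_pos (show 0 < (a + 1) / 2 by linarith)
  refine mul_lt_mul' ?_ ?_ (Real.exp_pos _).le (by positivity)
  · have : V ((b + 1) / 2) ≤ V ((a + 1) / 2) :=
      V_antitoneOn (Set.mem_Ioi.2 (by linarith)) (Set.mem_Ioi.2 (by linarith)) (by linarith)
    gcongr
  · exact Real.exp_lt_exp.2 (log_elementary_factor_strictAntiOn ⟨ha, by linarith⟩
      ⟨by linarith, hb⟩ hab)

theorem abs_g_strictAnti {a b : ℝ} (ha : 1 ≤ a) (hab : a < b) (hb : b < 2) {k : ℕ} (hk : 2 ≤ k) :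
    |g b k| < |g a k| := by
  induction k, hk using Nat.le_induction with
  | base => exact abs_g_two_strictAnti ha hab hb
  | succ k hk ih =>
    have hk' : (2 : ℝ) ≤ k := by exact_mod_cast hk
    have ha0 : 0 < a := by linarith
    have hb0 : 0 < b := by linarith
    rw [abs_g_succ hb0 hb (by omega), abs_g_succ ha0 (by linarith) (by omega)]
    have h1 : 0 ≤ 1 - 2 * (b + 1) / (b + 2 * ((k : ℝ) + 1)) := by
      rw [sub_nonneg, div_le_one (by positivity)]
      linarith
    have h2 : 2 * (a + 1) / (a + 2 * ((k : ℝ) + 1)) < 2 * (b + 1) / (b + 2 * ((k : ℝ) + 1)) := by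
      rw [div_lt_div_iff₀ (by positivity) (by positivity)]
      nlinarith
    exact mul_lt_mul'' (by linarith) ih h1 (abs_nonneg _)

theorem g_natCast_strictMono {a b : ℝ} (ha : 1 ≤ a) (hab : a < b) (hb : b ≤ 2) {k : ℕ}
    (hk : k ≠ 1) : g a k < g b k := by
  rcases Nat.eq_zero_or_pos k with rfl | hk0
  · exact g_zero_strictMono (by linarith) hab
  have hna := g_neg_of_one_le (show 0 < a by linarith) (by linarith) hk0
  -- At `b = 2` the coefficient with `k ≥ 2` vanishes, and negativity of `g a k` suffices.
  rcases hb.lt_or_eq with hb' | rfl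
  · have h := abs_g_strictAnti ha hab hb' (k := k) (by omega)
    rw [abs_of_neg hna, abs_of_neg (g_neg_of_one_le (by linarith) hb' hk0)] at h
    linarith
  · rw [g_two_eq_zero (by omega : 2 ≤ k)]
    exact hna

theorem g_one_strictAnti {a b : ℝ} (ha : 0 < a) (hab : a < b) : g b 1 < g a 1 := by
  have hb : 0 < b := ha.trans hab
  rw [g_one ha, g_one hb, neg_mul, neg_mul, neg_lt_neg_iff]
  refine mul_lt_mul'' ?_ (g_zero_strictMono ha hab) (by positivity) (g_zero_pos ha).le
  rw [div_lt_div_iff₀ (by linarith) (by linarith)]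
  linarith

end FracCentred

theorem theorem1 :
    (∀ α : ℝ, 1 < α → α < 2 →
      -- (i) the single coefficients
      (∀ k : ℕ, 3 ≤ k →
        FracCentred.S α * ((α + 4) / (α + 2 * (k : ℝ))) ^ (2 * (α + 1)) < |FracCentred.g α (k : ℤ)| ∧
        |FracCentred.g α (k : ℤ)| <
          FracCentred.S α * ((α + 6) / (α + 2 * ((k : ℝ) + 1))) ^ (α + 1)) ∧
      -- (ii) finite sums
      (∀ n m : ℕ, 3 ≤ n → n ≤ m →
        FracCentred.P₁ m n α * ((α + 4) ^ (2 * (α + 1)) / (2 * (2 * α + 1))) <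
          ∑ k ∈ Finset.Icc n m, |FracCentred.g α (k : ℤ)| ∧
        ∑ k ∈ Finset.Icc n m, |FracCentred.g α (k : ℤ)| <
          FracCentred.P₂ m n α * ((α + 6) ^ (α + 1) / (2 * α))) ∧
      -- (iii) infinite sums over `k ≥ n`
      (∀ n : ℕ, 3 ≤ n →
        Summable (fun k : {k : ℕ // n ≤ k} => |FracCentred.g α ((k : ℕ) : ℤ)|) ∧
        FracCentred.Q₁ n α * ((α + 4) ^ (2 * (α + 1)) / (2 * (2 * α + 1))) <
          ∑' k : {k : ℕ // n ≤ k}, |FracCentred.g α ((k : ℕ) : ℤ)| ∧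
        ∑' k : {k : ℕ // n ≤ k}, |FracCentred.g α ((k : ℕ) : ℤ)| <
          FracCentred.Q₂ n α * ((α + 6) ^ (α + 1) / (2 * α))) ∧
      -- (iv) the two-sided infinite sum over `k ≠ 0`
      (Summable (fun k : {k : ℤ // k ≠ 0} => |FracCentred.g α (k : ℤ)|) ∧
        (2 : ℝ) ^ (1 + α) / ((1 + α) * Real.pi) ≤
          ∑' k : {k : ℤ // k ≠ 0}, |FracCentred.g α (k : ℤ)| ∧
        ∑' k : {k : ℤ // k ≠ 0}, |FracCentred.g α (k : ℤ)| ≤ (2 : ℝ) ^ (1 + α) / Real.pi)) ∧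
    -- (v) monotonicity in the order
    (∀ α₁ α₂ : ℝ, 1 ≤ α₁ → α₁ < α₂ → α₂ ≤ 2 →
      (∀ k : ℤ, k ≠ 1 → k ≠ -1 → FracCentred.g α₁ k < FracCentred.g α₂ k) ∧
      (∀ k : ℤ, k = 1 ∨ k = -1 → FracCentred.g α₂ k < FracCentred.g α₁ k)) := by
  refine ⟨fun α hα hα2 => ⟨fun k hk => ⟨FracCentred.lower_lt_abs_g hα hα2 hk,
    FracCentred.abs_g_lt_upper hα hα2 hk⟩, fun n m hn hnm => FracCentred.sum_Icc_bounds hα hα2 hn hnm,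
    fun n hn => FracCentred.tail_bounds hα hα2 hn, ?_⟩, fun a b ha hab hb => ⟨fun k h1 h2 => ?_, ?_⟩⟩
  · have h := FracCentred.hasSum_abs_g_ne_zero hα hα2
    rw [h.tsum_eq]
    exact ⟨h.summable, FracCentred.g_zero_bounds hα hα2⟩
  · obtain ⟨j, rfl | rfl⟩ := k.eq_nat_or_neg
    · exact FracCentred.g_natCast_strictMono ha hab hb (by omega)
    · rw [FracCentred.g_neg, FracCentred.g_neg]
      exact FracCentred.g_natCast_strictMono ha hab hb (by omega)
  · rintro k (rfl | rfl)
    · exact FracCentred.g_one_strictAnti (by linarith) hab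
    · rw [FracCentred.g_neg, FracCentred.g_neg]
      exact FracCentred.g_one_strictAnti (by linarith) hab
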